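/- Let $P$ be a semigroup with unit element. Call $P$ *left Ore* if it is (left and right) cancellative and right reversible, i.e. any two non-empty left ideals of $P$ have non-empty intersection. The *constructible right ideals* of $P$ are the members of the smallest family $\mathcal J$ of right ideals of $P$ that contains $\emptyset$ and $P$, is closed under finite intersections, and satisfies $pX\in\mathcal J$ and $p^{-1}X=\{q\in P: pq\in X\}\in\mathcal J$ for all $X\in\mathcal J$, $p\in P$. They are called *independent* if, whenever $X=\bigcup_{j=1}^n X_j$ with $n\ge 1$ and $X,X_1,\dots,X_n\in\mathcal J$, one has $X=X_j$ for some $j$. For $p\in P$ let $V_p$ be the isometry of $\ell^2(P)$ with $V_p\varepsilon_x=\varepsilon_{px}$ on the canonical orthonormal basis $(\varepsilon_x)_{x\in P}$, and let $C^*_r(P)\subseteq\mathcal L(\ell^2(P))$ be the C*-algebra generated by $\{V_p: p\in P\}$. Let $P$ be a left Ore semigroup whose constructible right ideals are independent. Then there exists a unique unital $*$-homomorphism $$\Delta_P: C^*_r(P)\to C^*_r(P)\otimes_{\min}C^*_r(P)\quad\text{with}\quad \Delta_P(V_p)=V_p\otimes V_p\ \text{ for all } p\in P,$$ where $\otimes_{\min}$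 is the minimal (spatial) tensor product, i.e. the norm closure of the algebraic tensor product $C^*_r(P)\odot C^*_r(P)$ in $\mathcal L(\ell^2(P)\otimes\ell^2(P))$. -/

import Mathlib

open scoped TensorProduct lp

namespace SemigroupCStar

section Semigroups

/-- A subset `X` of `P` is a left ideal if it is invariant under left multiplication. -/
def IsLeftIdeal {P : Type*} [Monoid P] (X : Set P) : Prop :=
  ∀ x ∈ X, ∀ p : P, p * x ∈ X

/-- Every pair of non-empty left ideals has a non-empty intersection. -/
def IsRightReversible (P : Type*) [Monoid P] : Prop :=
  ∀ X Y : Set P, IsLeftIdeal X → IsLeftIdeal Y → X.Nonempty → Y.Nonempty → (X ∩ Y).Nonempty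

/-- A left Ore semigroup (with unit): cancellative and right reversible. -/
class IsLeftOre (P : Type*) [Monoid P] : Prop extends IsCancelMul P where
  right_reversible : IsRightReversible P

/-- The constructible right ideals of `P`: the smallest family of subsets containing `∅` and `P`
and closed under `X ↦ pX`, `X ↦ p⁻¹X = {q | pq ∈ X}` and finite intersections.
(All its members are right ideals, see `IsConstructible.mul_mem`.) -/
inductive IsConstructible {P : Type*} [Monoid P] : Set P → Prop
  | empty : IsConstructible ∅
  | univ : IsConstructible Set.univ
  | mul_left (p : P) {X : Set P} : IsConstructible X → IsConstructible ((fun x => p * x) '' X)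
  | preimage (p : P) {X : Set P} : IsConstructible X → IsConstructible {q | p * q ∈ X}
  | inter {X Y : Set P} : IsConstructible X → IsConstructible Y → IsConstructible (X ∩ Y)

theorem IsConstructible.mul_mem {P : Type*} [Monoid P] {X : Set P} (hX : IsConstructible X) :
    ∀ x ∈ X, ∀ p : P, x * p ∈ X := by
  induction hX with
  | empty => intro x hx; exact hx.elim
  | univ => intro x _ p; trivial
  | mul_left q _ ih =>
    rintro _ ⟨y, hy, rfl⟩ p
    exact ⟨y * p, ih y hy p, (mul_assoc q y p).symm⟩
  | preimage q _ ih =>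
    intro x hx p
    have := ih _ hx p
    simpa [mul_assoc] using this
  | inter _ _ ih₁ ih₂ => exact fun x hx p => ⟨ih₁ x hx.1 p, ih₂ x hx.2 p⟩

/-- The constructible right ideals of `P` are independent: a constructible right ideal that is the
union of finitely many (at least one) constructible right ideals is equal to one of them. -/
def ConstructibleIndependent (P : Type*) [Monoid P] : Prop :=
  ∀ (n : ℕ) (X : Set P) (Y : Fin (n + 1) → Set P), IsConstructible X →
    (∀ j, IsConstructible (Y j)) → X = ⋃ j, Y j → ∃ j, X = Y j

end Semigroups

noncomputable section

section Reduced

open Classical in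
/-- The canonical orthonormal basis vector `ε_x` of `ℓ²(P)`. -/
def basisVec {P : Type*} (x : P) : ℓ²(P, ℂ) := lp.single 2 x (1 : ℂ)

theorem orthonormal_basisVec {P : Type*} : Orthonormal ℂ (basisVec : P → ℓ²(P, ℂ)) := by
  classical
  rw [orthonormal_iff_ite]
  intro i j
  simp only [basisVec, lp.inner_single_left, lp.single_apply]
  by_cases h : i = j
  · subst h; simp
  · simp [h]

variable {P : Type*} [Monoid P] [IsLeftCancelMul P]

theorem orthonormal_basisVec_mul (p : P) :
    Orthonormal ℂ (fun x : P => (basisVec (p * x) : ℓ²(P, ℂ))) :=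
  orthonormal_basisVec.comp _ (mul_right_injective p)

/-- The isometry `V_p` on `ℓ²(P)`, `V_p (∑ c_x ε_x) = ∑ c_x ε_{px}`. -/
def regIsometry (p : P) : ℓ²(P, ℂ) →ₗᵢ[ℂ] ℓ²(P, ℂ) :=
  (orthonormal_basisVec_mul p).orthogonalFamily.linearIsometry

theorem regIsometry_basisVec (p x : P) : regIsometry p (basisVec x) = basisVec (p * x) := by
  classical
  have h := (orthonormal_basisVec_mul p).orthogonalFamily.linearIsometry_apply_single
    (i := x) (1 : ℂ)
  simp only [LinearIsometry.toSpanSingleton_apply, one_smul] at h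
  rw [← h]
  simp only [regIsometry, basisVec]

variable (P) in
/-- The reduced semigroup C⋆-algebra: the C⋆-subalgebra of the bounded operators on `ℓ²(P)`
generated by the isometries `V_p`. (It contains the identity since `V_1 = 1`.) -/
def reducedCStar : StarSubalgebra ℂ (ℓ²(P, ℂ) →L[ℂ] ℓ²(P, ℂ)) :=
  (StarAlgebra.adjoin ℂ
    (Set.range fun p : P => (regIsometry p).toContinuousLinearMap)).topologicalClosure

/-- `V_p` as an element of the reduced semigroup C⋆-algebra. -/
def genV (p : P) : reducedCStar P :=
  ⟨(regIsometry p).toContinuousLinearMap,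
    StarSubalgebra.le_topologicalClosure _ (StarAlgebra.subset_adjoin ℂ _ ⟨p, rfl⟩)⟩

end Reduced

section MinTensor

section Operators

variable {H K : Type*} [NormedAddCommGroup H] [InnerProductSpace ℂ H]
  [NormedAddCommGroup K] [InnerProductSpace ℂ K]

variable (H K) in
/-- The Hilbert space tensor product of `H` and `K`: the completion of the algebraic tensor product
for the inner product `⟨x ⊗ y, x' ⊗ y'⟩ = ⟨x, x'⟩ ⟨y, y'⟩`. -/
def HilbertTensor : Type _ := UniformSpace.Completion (H ⊗[ℂ] K)

instance : NormedAddCommGroup (HilbertTensor H K) :=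
  inferInstanceAs (NormedAddCommGroup (UniformSpace.Completion (H ⊗[ℂ] K)))

instance : InnerProductSpace ℂ (HilbertTensor H K) :=
  inferInstanceAs (InnerProductSpace ℂ (UniformSpace.Completion (H ⊗[ℂ] K)))

instance : CompleteSpace (HilbertTensor H K) :=
  inferInstanceAs (CompleteSpace (UniformSpace.Completion (H ⊗[ℂ] K)))

/-- The canonical isometric embedding of the algebraic tensor product. -/
def toHilbertTensor : H ⊗[ℂ] K →ₗᵢ[ℂ] HilbertTensor H K :=
  UniformSpace.Completion.toComplₗᵢ (𝕜 := ℂ) (E := H ⊗[ℂ] K)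

theorem denseRange_toHilbertTensor :
    DenseRange (toHilbertTensor : H ⊗[ℂ] K →ₗᵢ[ℂ] HilbertTensor H K) :=
  UniformSpace.Completion.denseRange_coe

/-- The operator `S ⊗ T` on the Hilbert space tensor product. -/
def opTensor (S : H →L[ℂ] H) (T : K →L[ℂ] K) : HilbertTensor H K →L[ℂ] HilbertTensor H K :=
  ContinuousLinearMap.completion (TensorProduct.mapL S T)

theorem opTensor_tmul (S : H →L[ℂ] H) (T : K →L[ℂ] K) (x : H) (y : K) :
    opTensor S T (toHilbertTensor (x ⊗ₜ[ℂ] y)) = toHilbertTensor (S x ⊗ₜ[ℂ] T y) :=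
  ContinuousLinearMap.completion_apply_coe (TensorProduct.mapL S T) (x ⊗ₜ[ℂ] y)

end Operators

variable {H K : Type*} [NormedAddCommGroup H] [InnerProductSpace ℂ H] [CompleteSpace H]
  [NormedAddCommGroup K] [InnerProductSpace ℂ K] [CompleteSpace K]

/-- The minimal (spatial) tensor product of two concrete C⋆-algebras `A` on `H` and `B` on `K`: the
C⋆-algebra of operators on the Hilbert space tensor product generated by the `a ⊗ b`, which is the
norm closure of the linear span of these operators. -/
def minTensor (A : StarSubalgebra ℂ (H →L[ℂ] H)) (B : StarSubalgebra ℂ (K →L[ℂ] K)) :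
    StarSubalgebra ℂ (HilbertTensor H K →L[ℂ] HilbertTensor H K) :=
  (StarAlgebra.adjoin ℂ
    (Set.range fun ab : A × B => opTensor (ab.1 : H →L[ℂ] H)
      (ab.2 : K →L[ℂ] K))).topologicalClosure

/-- The elementary tensor `a ⊗ b` in the minimal tensor product. -/
def minTmul {A : StarSubalgebra ℂ (H →L[ℂ] H)} {B : StarSubalgebra ℂ (K →L[ℂ] K)}
    (a : A) (b : B) : minTensor A B :=
  ⟨opTensor (a : H →L[ℂ] H) (b : K →L[ℂ] K),
    StarSubalgebra.le_topologicalClosure _ (StarAlgebra.subset_adjoin ℂ _ ⟨(a, b), rfl⟩)⟩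

end MinTensor

end

end SemigroupCStar

/-!
The unitary case is Fell absorption; here it is replaced by a finite approximation argument that
stays inside the semigroup.

The operators `V_p ⊗ V_p` act on the basis vectors `ε_x ⊗ ε_y` through the diagonal action of `P`
on `P × P`. Call two points equivalent if they have a common translate (`diagSetoid`); right
reversibility makes this an equivalence relation, and the `⋆`-algebra generated by the `V_p ⊗ V_p`
preserves the mutually orthogonal spans of the classes. On each class the diagonal action is
simulated by the left regular action of `P` on itself, in the following sense
(`exists_simulation`): for every finite part `S` of a class there is an injective map `z : S → P`
that commutes with translation by elements of `P` as far as this makes sense in `S`, and `z σ` is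
divisible by `p` only if `σ` is, for finitely many prescribed `p`. The points of `S` have a common
translate `q σ • σ = m`, and the requirements on `z` amount to an element of `⋂ q σ P` outside
finitely many ideals `q σ p P`. Each of these fails to contain both coordinates of `m`, so
independence of the constructible right ideals provides this element.

Consequently, for every `⋆`-polynomial in the generators, the value at `V_p ⊗ V_p` acts on a
finitely supported vector of one class exactly as the value at `V_p` acts on its image under `z`,
as soon as `S` is large enough (`Simulated`). Hence the norm of the former value is at most that of
the latter (`Simulated.norm_snd_le`). The closed `⋆`-algebra generated by the pairs
`(V_p, V_p ⊗ V_p)` is therefore the graph of a map on `C*_r(P)`, which is the comultiplication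
(`comul`). Uniqueness is automatic continuity of `⋆`-homomorphisms (`reducedCStar_hom_ext`).
-/

namespace SemigroupCStar

open Filter

/-! ### Orbits of the diagonal action -/

section Combinatorics

variable {P : Type*} [Monoid P]

theorem IsRightReversible.exists_common_multiple (h : IsRightReversible P) (a b : P) :
    ∃ c d : P, c * a = d * b := by
  obtain ⟨_, ⟨c, rfl⟩, d, hd⟩ := h (Set.range (· * a)) (Set.range (· * b))
    (by rintro _ ⟨x, rfl⟩ p; exact ⟨p * x, mul_assoc ..⟩)
    (by rintro _ ⟨x, rfl⟩ p; exact ⟨p * x, mul_assoc ..⟩)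
    (Set.range_nonempty _) (Set.range_nonempty _)
  exact ⟨c, d, hd.symm⟩

theorem IsConstructible.principal (p : P) : IsConstructible (Set.range fun x => p * x) := by
  rw [← Set.image_univ]
  exact IsConstructible.univ.mul_left p

open Classical in
theorem isConstructible_finset_iInter {ι : Type*} (S : Finset ι) (X : ι → Set P)
    (hX : ∀ i ∈ S, IsConstructible (X i)) : IsConstructible (⋂ i ∈ S, X i) := by
  induction S using Finset.induction_on with
  | empty => simpa using IsConstructible.univ
  | insert i S _ ih =>
    rw [Finset.set_biInter_insert]
    exact (hX i (Finset.mem_insert_self i S)).inter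
      (ih fun j hj => hX j (Finset.mem_insert_of_mem hj))

/-- Independence in the form in which it is applied: a nonempty constructible right ideal that is
contained in none of finitely many others has an element outside all of them. -/
theorem ConstructibleIndependent.exists_notMem (hJ : ConstructibleIndependent P) {ι : Type*}
    (S : Finset ι) {I : Set P} (hI : IsConstructible I) (hne : I.Nonempty) (Y : ι → Set P)
    (hY : ∀ i ∈ S, IsConstructible (Y i)) (h : ∀ i ∈ S, ¬ I ⊆ Y i) :
    ∃ s ∈ I, ∀ i ∈ S, s ∉ Y i := by
  by_contra! hcon
  obtain ⟨x, hx⟩ := hne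
  obtain ⟨i₀, hi₀, -⟩ := hcon x hx
  obtain ⟨n, hn⟩ : ∃ n, S.card = n + 1 :=
    Nat.exists_eq_succ_of_ne_zero (Finset.card_ne_zero_of_mem hi₀)
  let e := S.equivFinOfCardEq hn
  obtain ⟨j, hj⟩ := hJ n I (fun j => I ∩ Y (e.symm j)) hI
    (fun j => hI.inter (hY _ (e.symm j).2)) (by
      ext s
      simp only [Set.mem_iUnion, Set.mem_inter_iff]
      refine ⟨fun hs => ?_, fun ⟨_, hs, _⟩ => hs⟩
      obtain ⟨i, hi, hsi⟩ := hcon s hs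
      exact ⟨e ⟨i, hi⟩, hs, by simpa using hsi⟩)
  exact h _ (e.symm j).2 (hj.le.trans Set.inter_subset_right)

variable [IsLeftOre P]

theorem exists_common_multiple (a b : P) : ∃ c d : P, c * a = d * b :=
  IsLeftOre.right_reversible.exists_common_multiple a b

variable (P) in
/-- Two points of `P × P` are equivalent if they have a common translate under the diagonal left
action of `P`. Inside the group of left fractions of `P` this says that `(x, y)` and `(x', y')`
satisfy `x⁻¹y = x'⁻¹y'`. -/
def diagSetoid : Setoid (P × P) where
  r σ τ := ∃ a b : P, a • σ = b • τ
  iseqv :=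
    { refl := fun _ => ⟨1, 1, rfl⟩
      symm := fun ⟨a, b, h⟩ => ⟨b, a, h.symm⟩
      trans := by
        rintro σ τ υ ⟨a, a', h⟩ ⟨b, b', h'⟩
        obtain ⟨c, d, hcd⟩ := exists_common_multiple a' b
        exact ⟨c * a, d * b', by rw [mul_smul, h, ← mul_smul, hcd, mul_smul, h', mul_smul]⟩ }

variable (P) in
/-- The set of classes of `P × P` modulo the diagonal action. -/
abbrev DiagQuotient := Quotient (diagSetoid P)

/-- The points of `P × P` in a given class. -/
abbrev DiagClass (c : DiagQuotient P) := {σ : P × P // Quotient.mk (diagSetoid P) σ = c}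

/-- The diagonal action of `P` on a class. -/
def DiagClass.translate {c : DiagQuotient P} (p : P) (σ : DiagClass c) : DiagClass c :=
  ⟨p • σ.1, (Quotient.sound (s := diagSetoid P) ⟨1, p, one_smul P _⟩).trans σ.2⟩

open Classical in
/-- Finitely many points of one class have a common translate. -/
theorem exists_common_translate {c : DiagQuotient P} (S : Finset (DiagClass c)) :
    ∃ (q : DiagClass c → P) (m : P × P), ∀ σ ∈ S, q σ • σ.1 = m := by
  -- A fixed base point `σ₀` is carried along, so that a new point has something to be compared to.
  obtain ⟨σ₀, hσ₀⟩ := Quotient.exists_rep c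
  suffices h : ∃ (q : DiagClass c → P) (q₀ : P), ∀ σ ∈ S, q σ • σ.1 = q₀ • σ₀ by
    obtain ⟨q, q₀, h⟩ := h
    exact ⟨q, _, h⟩
  induction S using Finset.induction_on with
  | empty => exact ⟨1, 1, by simp⟩
  | insert τ S hτ ih =>
    obtain ⟨q, q₀, h⟩ := ih
    obtain ⟨a, a', ha⟩ : ∃ a b : P, a • τ.1 = b • σ₀ :=
      Quotient.exact (s := diagSetoid P) (τ.2.trans hσ₀.symm)
    obtain ⟨b, d, hbd⟩ := exists_common_multiple a' q₀
    refine ⟨fun σ => if σ = τ then b * a else d * q σ, d * q₀, fun σ hσ => ?_⟩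
    dsimp only
    by_cases hστ : σ = τ
    · subst hστ
      rw [if_pos rfl, mul_smul, ha, ← mul_smul, hbd]
    · rw [if_neg hστ, mul_smul, h σ (Finset.mem_of_mem_insert_of_ne hσ hστ), mul_smul]

/-- The left regular action simulates the diagonal action on finite sets. On a finite part `S` of a
class there is an injective map to `P` that commutes with translations and reflects divisibility by
the elements of a given finite set `F`.

With `q σ • σ = m` for `σ ∈ S`, take `z σ` to be the solution of `q σ * z σ = s`, where `s` lies
in all `q σ P` but in none of the ideals `q σ p P` for which `p` does not divide `σ`. Such an `s`
exists by independence: both coordinates of `m` lie in all `q σ P`, while if both lie in `q σ p P`,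
then `p` divides `σ`. -/
theorem exists_simulation (hJ : ConstructibleIndependent P) {c : DiagQuotient P}
    (S : Finset (DiagClass c)) (F : Finset P) :
    ∃ z : DiagClass c → P, (∀ σ ∈ S, ∀ τ ∈ S, z σ = z τ → σ = τ) ∧
      (∀ p, ∀ σ ∈ S, σ.translate p ∈ S → z (σ.translate p) = p * z σ) ∧
      (∀ p ∈ F, ∀ σ ∈ S, (∃ y, p * y = z σ) → ∃ τ : DiagClass c, τ.translate p = σ) := by
  classical
  obtain ⟨q, m, hq⟩ := exists_common_translate S
  have hm₁ : ∀ σ ∈ S, q σ * σ.1.1 = m.1 := fun σ hσ => congrArg Prod.fst (hq σ hσ)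
  have hm₂ : ∀ σ ∈ S, q σ * σ.1.2 = m.2 := fun σ hσ => congrArg Prod.snd (hq σ hσ)
  have hmem₁ : m.1 ∈ ⋂ σ ∈ S, Set.range fun x => q σ * x := by
    simp only [Set.mem_iInter]; exact fun σ hσ => ⟨_, hm₁ σ hσ⟩
  have hmem₂ : m.2 ∈ ⋂ σ ∈ S, Set.range fun x => q σ * x := by
    simp only [Set.mem_iInter]; exact fun σ hσ => ⟨_, hm₂ σ hσ⟩
  obtain ⟨s, hs, hsY⟩ := hJ.exists_notMem
    ((S ×ˢ F).filter fun i => ¬ ∃ τ : DiagClass c, τ.translate i.2 = i.1)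
    (isConstructible_finset_iInter S _ fun σ _ => IsConstructible.principal (q σ)) ⟨_, hmem₁⟩
    (fun i => Set.range fun x => (q i.1 * i.2) * x) (fun i _ => IsConstructible.principal _) (by
      rintro ⟨σ, p⟩ hi hsub
      simp only [Finset.mem_filter, Finset.mem_product] at hi
      obtain ⟨⟨hσ, -⟩, hdiv⟩ := hi
      obtain ⟨u, hu⟩ := hsub hmem₁
      obtain ⟨v, hv⟩ := hsub hmem₂
      have hσ' : p • (u, v) = σ.1 := by
        refine Prod.ext (mul_left_cancel (a := q σ) ?_) (mul_left_cancel (a := q σ) ?_)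
        · rw [hm₁ σ hσ, ← hu]; exact (mul_assoc ..).symm
        · rw [hm₂ σ hσ, ← hv]; exact (mul_assoc ..).symm
      refine hdiv ⟨⟨(u, v), ?_⟩, Subtype.ext hσ'⟩
      rw [← σ.2]
      exact Quotient.sound (s := diagSetoid P) ⟨p, 1, by rw [hσ', one_smul]⟩)
  simp only [Set.mem_iInter] at hs
  choose! z hz using hs
  dsimp only at hz
  refine ⟨z, fun σ hσ τ hτ h => ?_, fun p σ hσ hpσ => ?_, fun p hp σ hσ ⟨y, hy⟩ => ?_⟩
  · have hqq : q σ = q τ := mul_right_cancel (b := z σ) (by rw [hz σ hσ, h, hz τ hτ])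
    refine Subtype.ext (Prod.ext (mul_left_cancel (a := q σ) ?_) (mul_left_cancel (a := q σ) ?_))
    · rw [hm₁ σ hσ, hqq, hm₁ τ hτ]
    · rw [hm₂ σ hσ, hqq, hm₂ τ hτ]
  · have hqq : q (σ.translate p) * p = q σ := by
      refine mul_right_cancel (b := σ.1.1) ?_
      rw [hm₁ σ hσ, mul_assoc]
      exact hm₁ _ hpσ
    refine mul_left_cancel (a := q (σ.translate p)) ?_
    rw [hz _ hpσ, ← mul_assoc, hqq, hz σ hσ]
  · by_contra hdiv
    refine hsY (σ, p) (Finset.mem_filter.2 ⟨Finset.mk_mem_product hσ hp, hdiv⟩) ⟨y, ?_⟩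
    dsimp only
    rw [mul_assoc, hy, hz σ hσ]

/-- A choice of the map provided by `exists_simulation`. -/
noncomputable def simulation (hJ : ConstructibleIndependent P) (c : DiagQuotient P)
    (i : Finset (DiagClass c) × Finset P) : DiagClass c → P :=
  (exists_simulation hJ i.1 i.2).choose

variable (hJ : ConstructibleIndependent P) {c : DiagQuotient P}

theorem eventually_subset (S : Finset (DiagClass c)) (F : Finset P) :
    ∀ᶠ i : Finset (DiagClass c) × Finset P in atTop, S ⊆ i.1 ∧ F ⊆ i.2 :=
  eventually_ge_atTop (S, F)

theorem eventually_simulation_injOn (S : Finset (DiagClass c)) :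
    ∀ᶠ i in atTop, ∀ σ ∈ S, ∀ τ ∈ S, simulation hJ c i σ = simulation hJ c i τ → σ = τ := by
  filter_upwards [eventually_subset S ∅] with i hi σ hσ τ hτ
  exact (exists_simulation hJ i.1 i.2).choose_spec.1 σ (hi.1 hσ) τ (hi.1 hτ)

theorem eventually_simulation_translate (p : P) (σ : DiagClass c) :
    ∀ᶠ i in atTop, simulation hJ c i (σ.translate p) = p * simulation hJ c i σ := by
  classical
  filter_upwards [eventually_subset {σ, σ.translate p} ∅] with i hi
  exact (exists_simulation hJ i.1 i.2).choose_spec.2.1 p σ (hi.1 (by simp)) (hi.1 (by simp))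

theorem eventually_simulation_not_dvd (p : P) (σ : DiagClass c)
    (h : ¬ ∃ τ : DiagClass c, τ.translate p = σ) :
    ∀ᶠ i in atTop, ∀ y, p * y ≠ simulation hJ c i σ := by
  filter_upwards [eventually_subset {σ} {p}] with i hi y hy
  exact h ((exists_simulation hJ i.1 i.2).choose_spec.2.2 p (hi.2 (by simp)) σ (hi.1 (by simp))
    ⟨y, hy⟩)

end Combinatorics

/-! ### Orthonormal families -/

section Hilbert

variable {H K : Type*} [NormedAddCommGroup H] [InnerProductSpace ℂ H]
  [NormedAddCommGroup K] [InnerProductSpace ℂ K]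

theorem norm_linearCombination_congr {ι : Type*} {u : ι → H} {v : ι → K} (ξ : ι →₀ ℂ)
    (h : ∀ i ∈ ξ.support, ∀ j ∈ ξ.support, inner ℂ (u i) (u j) = inner ℂ (v i) (v j)) :
    ‖Finsupp.linearCombination ℂ u ξ‖ = ‖Finsupp.linearCombination ℂ v ξ‖ := by
  rw [norm_eq_sqrt_re_inner (𝕜 := ℂ), norm_eq_sqrt_re_inner (𝕜 := ℂ)]
  congr 2
  simp only [Finsupp.linearCombination_apply, Finsupp.sum, sum_inner, inner_sum, inner_smul_left,
    inner_smul_right]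
  refine Finset.sum_congr rfl fun i hi => congrArg _ (Finset.sum_congr rfl fun j hj => ?_)
  rw [h j hj i hi]

/-- A vector is determined by its inner products with a total family. -/
theorem eq_of_inner_total {ι : Type*} {e : ι → H}
    (hd : Dense (Submodule.span ℂ (Set.range e) : Set H)) {x y : H}
    (h : ∀ i, inner ℂ (e i) x = inner ℂ (e i) y) : x = y := by
  refine hd.eq_of_inner_right ℂ fun v hv => ?_
  induction hv using Submodule.span_induction with
  | mem v hv => obtain ⟨i, rfl⟩ := hv; exact h i
  | zero => simp
  | add v w _ _ hv hw => rw [inner_add_left, inner_add_left, hv, hw]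
  | smul a v _ hv => rw [inner_smul_left, inner_smul_left, hv]

variable [CompleteSpace H]

theorem star_apply_of_apply_basis {ι : Type*} {e : ι → H} (he : Orthonormal ℂ e)
    (hd : Dense (Submodule.span ℂ (Set.range e) : Set H)) {T : H →L[ℂ] H} {f : ι → ι}
    (hf : Function.Injective f) (hT : ∀ i, T (e i) = e (f i)) (i : ι) :
    star T (e (f i)) = e i := by
  classical
  refine eq_of_inner_total hd fun j => ?_
  rw [ContinuousLinearMap.star_eq_adjoint, ContinuousLinearMap.adjoint_inner_right, hT,
    orthonormal_iff_ite.1 he, orthonormal_iff_ite.1 he]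
  simp only [hf.eq_iff]

theorem star_apply_eq_zero_of_apply_basis {ι : Type*} {e : ι → H} (he : Orthonormal ℂ e)
    (hd : Dense (Submodule.span ℂ (Set.range e) : Set H)) {T : H →L[ℂ] H} {f : ι → ι}
    (hT : ∀ i, T (e i) = e (f i)) {j : ι} (hj : ∀ i, f i ≠ j) : star T (e j) = 0 := by
  refine eq_of_inner_total hd fun i => ?_
  rw [ContinuousLinearMap.star_eq_adjoint, ContinuousLinearMap.adjoint_inner_right, hT,
    he.inner_eq_zero (hj i), inner_zero_right]

end Hilbert

section Bases

variable {P : Type*}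

theorem dense_span_basisVec :
    Dense (Submodule.span ℂ (Set.range (basisVec : P → ℓ²(P, ℂ))) : Set ℓ²(P, ℂ)) := by
  classical
  intro f
  refine mem_closure_of_tendsto (lp.hasSum_single (E := fun _ : P => ℂ) (p := 2) (by simp) f)
    (Eventually.of_forall fun s => Submodule.sum_mem _ fun x _ => ?_)
  have h : lp.single (E := fun _ : P => ℂ) 2 x (f x) = f x • basisVec x := by
    rw [basisVec, ← lp.single_smul, smul_eq_mul, mul_one]
  rw [h]
  exact Submodule.smul_mem _ _ (Submodule.subset_span ⟨x, rfl⟩)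

/-- The canonical orthonormal basis vector `ε_x ⊗ ε_y` of `ℓ²(P) ⊗ ℓ²(P)`. -/
noncomputable def tensorBasisVec (σ : P × P) : HilbertTensor ℓ²(P, ℂ) ℓ²(P, ℂ) :=
  toHilbertTensor (basisVec σ.1 ⊗ₜ[ℂ] basisVec σ.2)

theorem orthonormal_tensorBasisVec : Orthonormal ℂ (tensorBasisVec : P × P → _) := by
  classical
  rw [orthonormal_iff_ite]
  rintro ⟨x, y⟩ ⟨x', y'⟩
  rw [tensorBasisVec, tensorBasisVec, LinearIsometry.inner_map_map, TensorProduct.inner_tmul,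
    orthonormal_iff_ite.1 orthonormal_basisVec, orthonormal_iff_ite.1 orthonormal_basisVec]
  by_cases hx : x = x' <;> by_cases hy : y = y' <;> simp [hx, hy]

theorem continuous_toHilbertTensor_tmul {H K : Type*} [NormedAddCommGroup H]
    [InnerProductSpace ℂ H] [NormedAddCommGroup K] [InnerProductSpace ℂ K] :
    (∀ y : K, Continuous fun x : H => toHilbertTensor (x ⊗ₜ[ℂ] y)) ∧
      ∀ x : H, Continuous fun y : K => toHilbertTensor (x ⊗ₜ[ℂ] y) := by
  refine ⟨fun y => ?_, fun x => ?_⟩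
  · refine AddMonoidHomClass.continuous_of_bound
      (toHilbertTensor.toLinearMap ∘ₗ (TensorProduct.mk ℂ H K).flip y) ‖y‖ fun x => ?_
    simp [mul_comm]
  · refine AddMonoidHomClass.continuous_of_bound
      (toHilbertTensor.toLinearMap ∘ₗ TensorProduct.mk ℂ H K x) ‖x‖ fun y => ?_
    simp

theorem dense_span_tensorBasisVec :
    Dense (Submodule.span ℂ (Set.range (tensorBasisVec : P × P → _)) :
      Set (HilbertTensor ℓ²(P, ℂ) ℓ²(P, ℂ))) := by
  set D := (Submodule.span ℂ (Set.range (tensorBasisVec : P × P → _))).topologicalClosure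
  have hc : IsClosed (D : Set (HilbertTensor ℓ²(P, ℂ) ℓ²(P, ℂ))) :=
    Submodule.isClosed_topologicalClosure _
  have h₀ : ∀ x y : P, toHilbertTensor (basisVec x ⊗ₜ[ℂ] basisVec y) ∈ D := fun x y =>
    Submodule.le_topologicalClosure _ (Submodule.subset_span ⟨(x, y), rfl⟩)
  have h₁ : ∀ (f : ℓ²(P, ℂ)) (y : P), toHilbertTensor (f ⊗ₜ[ℂ] basisVec y) ∈ D := fun f y => by
    refine isClosed_property dense_span_basisVec.denseRange_val
      (hc.preimage (continuous_toHilbertTensor_tmul.1 (basisVec y))) (fun ⟨v, hv⟩ => ?_) f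
    change toHilbertTensor (v ⊗ₜ[ℂ] basisVec y) ∈ D
    induction hv using Submodule.span_induction with
    | mem v hv => obtain ⟨x, rfl⟩ := hv; exact h₀ x y
    | zero => simp
    | add v w _ _ hv hw => rw [TensorProduct.add_tmul, map_add]; exact D.add_mem hv hw
    | smul a v _ hv => rw [← TensorProduct.smul_tmul', map_smul]; exact D.smul_mem a hv
  have h₂ : ∀ f g : ℓ²(P, ℂ), toHilbertTensor (f ⊗ₜ[ℂ] g) ∈ D := fun f g => by
    refine isClosed_property dense_span_basisVec.denseRange_val
      (hc.preimage (continuous_toHilbertTensor_tmul.2 f)) (fun ⟨v, hv⟩ => ?_) g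
    change toHilbertTensor (f ⊗ₜ[ℂ] v) ∈ D
    induction hv using Submodule.span_induction with
    | mem v hv => obtain ⟨x, rfl⟩ := hv; exact h₁ f x
    | zero => simp
    | add v w _ _ hv hw => rw [TensorProduct.tmul_add, map_add]; exact D.add_mem hv hw
    | smul a v _ hv => rw [TensorProduct.tmul_smul, map_smul]; exact D.smul_mem a hv
  refine fun v => isClosed_property denseRange_toHilbertTensor hc (fun t => ?_) v
  induction t using TensorProduct.induction_on with
  | zero => rw [map_zero]; exact D.zero_mem
  | tmul f g => exact h₂ f g
  | add s t hs ht => rw [map_add]; exact D.add_mem hs ht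

end Bases
/-! ### The norm estimate -/

section Estimate

variable {P : Type*} [Monoid P] [IsLeftOre P]

theorem opTensor_regIsometry_tensorBasisVec (p : P) (σ : P × P) :
    opTensor (regIsometry p).toContinuousLinearMap (regIsometry p).toContinuousLinearMap
      (tensorBasisVec σ) = tensorBasisVec (p • σ) := by
  rw [tensorBasisVec, opTensor_tmul]
  exact congrArg toHilbertTensor
    (congrArg₂ _ (regIsometry_basisVec p σ.1) (regIsometry_basisVec p σ.2))

/-- A pair of operators on `ℓ²(P)` and on `ℓ²(P) ⊗ ℓ²(P)` is simulated if, on finitely supported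
vectors in the span of one class of basis vectors `ε_x ⊗ ε_y`, the maps of `exists_simulation`
eventually intertwine the second operator with the first. -/
def Simulated (hJ : ConstructibleIndependent P)
    (T : (ℓ²(P, ℂ) →L[ℂ] ℓ²(P, ℂ)) ×
      (HilbertTensor ℓ²(P, ℂ) ℓ²(P, ℂ) →L[ℂ] HilbertTensor ℓ²(P, ℂ) ℓ²(P, ℂ))) : Prop :=
  ∀ (c : DiagQuotient P) (ξ : DiagClass c →₀ ℂ), ∃ η : DiagClass c →₀ ℂ,
    T.2 (Finsupp.linearCombination ℂ (fun σ => tensorBasisVec σ.1) ξ) =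
        Finsupp.linearCombination ℂ (fun σ => tensorBasisVec σ.1) η ∧
      ∀ᶠ i in atTop,
        T.1 (Finsupp.linearCombination ℂ (fun σ => basisVec (simulation hJ c i σ)) ξ) =
          Finsupp.linearCombination ℂ (fun σ => basisVec (simulation hJ c i σ)) η

namespace Simulated

variable {hJ : ConstructibleIndependent P}
  {T T' : (ℓ²(P, ℂ) →L[ℂ] ℓ²(P, ℂ)) ×
    (HilbertTensor ℓ²(P, ℂ) ℓ²(P, ℂ) →L[ℂ] HilbertTensor ℓ²(P, ℂ) ℓ²(P, ℂ))}

theorem of_basis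
    (h : ∀ (c : DiagQuotient P) (σ : DiagClass c), ∃ η : DiagClass c →₀ ℂ,
      T.2 (tensorBasisVec σ.1) = Finsupp.linearCombination ℂ (fun σ => tensorBasisVec σ.1) η ∧
      ∀ᶠ i in atTop, T.1 (basisVec (simulation hJ c i σ)) =
        Finsupp.linearCombination ℂ (fun σ => basisVec (simulation hJ c i σ)) η) :
    Simulated hJ T := by
  intro c ξ
  induction ξ using Finsupp.induction_linear with
  | zero => exact ⟨0, by simp⟩
  | add ξ ξ' ih ih' =>
    obtain ⟨η, h₂, h₁⟩ := ih
    obtain ⟨η', h₂', h₁'⟩ := ih'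
    refine ⟨η + η', by simp only [map_add, h₂, h₂'], ?_⟩
    filter_upwards [h₁, h₁'] with i hi hi'
    simp only [map_add, hi, hi']
  | single σ a =>
    obtain ⟨η, h₂, h₁⟩ := h c σ
    refine ⟨a • η, by simp only [Finsupp.linearCombination_single, map_smul, h₂], ?_⟩
    filter_upwards [h₁] with i hi
    simp only [Finsupp.linearCombination_single, map_smul, hi]

theorem add (h : Simulated hJ T) (h' : Simulated hJ T') : Simulated hJ (T + T') := by
  intro c ξ
  obtain ⟨η, h₂, h₁⟩ := h c ξ
  obtain ⟨η', h₂', h₁'⟩ := h' c ξ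
  refine ⟨η + η', ?_, ?_⟩
  · rw [Prod.snd_add, add_apply, h₂, h₂', map_add]
  · filter_upwards [h₁, h₁'] with i hi hi'
    rw [Prod.fst_add, add_apply, hi, hi', map_add]

theorem mul (h : Simulated hJ T) (h' : Simulated hJ T') : Simulated hJ (T * T') := by
  intro c ξ
  obtain ⟨η', h₂', h₁'⟩ := h' c ξ
  obtain ⟨η, h₂, h₁⟩ := h c η'
  refine ⟨η, ?_, ?_⟩
  · rw [Prod.snd_mul, mul_apply_eq_comp, h₂', h₂]
  · filter_upwards [h₁, h₁'] with i hi hi'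
    rw [Prod.fst_mul, mul_apply_eq_comp, hi', hi]

theorem algebraMap (r : ℂ) : Simulated hJ (algebraMap ℂ _ r) := by
  intro c ξ
  refine ⟨r • ξ, ?_, Eventually.of_forall fun i => ?_⟩ <;>
  · rw [map_smul, Algebra.algebraMap_eq_smul_one]
    rfl

variable (hJ) in
theorem regIsometry (p : P) : Simulated hJ ((regIsometry p).toContinuousLinearMap,
    opTensor (SemigroupCStar.regIsometry p).toContinuousLinearMap
      (SemigroupCStar.regIsometry p).toContinuousLinearMap) := by
  refine of_basis fun c σ => ⟨Finsupp.single (σ.translate p) 1, ?_, ?_⟩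
  · rw [Finsupp.linearCombination_single, one_smul]
    exact opTensor_regIsometry_tensorBasisVec p σ.1
  · filter_upwards [eventually_simulation_translate hJ p σ] with i hi
    rw [Finsupp.linearCombination_single, one_smul, hi]
    exact regIsometry_basisVec p _

variable (hJ) in
theorem star_regIsometry (p : P) : Simulated hJ
    (star ((SemigroupCStar.regIsometry p).toContinuousLinearMap,
      opTensor (SemigroupCStar.regIsometry p).toContinuousLinearMap
        (SemigroupCStar.regIsometry p).toContinuousLinearMap)) := by
  have hp : Function.Injective fun x : P => p * x := mul_right_injective p
  have hp' : Function.Injective fun σ : P × P => p • σ := fun σ τ h =>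
    Prod.ext (hp (congrArg Prod.fst h)) (hp (congrArg Prod.snd h))
  refine of_basis fun c σ => ?_
  by_cases hσ : ∃ τ : DiagClass c, τ.translate p = σ
  · obtain ⟨τ, rfl⟩ := hσ
    refine ⟨Finsupp.single τ 1, ?_, ?_⟩
    · rw [Finsupp.linearCombination_single, one_smul]
      exact star_apply_of_apply_basis orthonormal_tensorBasisVec dense_span_tensorBasisVec hp'
        (opTensor_regIsometry_tensorBasisVec p) τ.1
    · filter_upwards [eventually_simulation_translate hJ p τ] with i hi
      rw [Finsupp.linearCombination_single, one_smul, hi]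
      exact star_apply_of_apply_basis orthonormal_basisVec dense_span_basisVec hp
        (regIsometry_basisVec p) _
  · refine ⟨0, ?_, ?_⟩
    · rw [map_zero]
      refine star_apply_eq_zero_of_apply_basis orthonormal_tensorBasisVec
        dense_span_tensorBasisVec (opTensor_regIsometry_tensorBasisVec p) fun τ hτ => ?_
      refine hσ ⟨⟨τ, ?_⟩, Subtype.ext hτ⟩
      rw [← σ.2]
      exact Quotient.sound (s := diagSetoid P) ⟨p, 1, by rw [hτ, one_smul]⟩
    · filter_upwards [eventually_simulation_not_dvd hJ p σ hσ] with i hi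
      rw [map_zero]
      exact star_apply_eq_zero_of_apply_basis orthonormal_basisVec dense_span_basisVec
        (regIsometry_basisVec p) hi

theorem norm_apply_linearCombination_le (h : Simulated hJ T) {c : DiagQuotient P}
    (ξ : DiagClass c →₀ ℂ) :
    ‖T.2 (Finsupp.linearCombination ℂ (fun σ => tensorBasisVec σ.1) ξ)‖ ≤
      ‖T.1‖ * ‖Finsupp.linearCombination ℂ (fun σ => tensorBasisVec (P := P) σ.1) ξ‖ := by
  classical
  obtain ⟨η, h₂, h₁⟩ := h c ξ
  obtain ⟨i, hi, hξ, hη⟩ := (h₁.and ((eventually_simulation_injOn hJ ξ.support).and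
    (eventually_simulation_injOn hJ η.support))).exists
  -- On vectors supported in a set where the simulating map is injective, it preserves the norm.
  have key : ∀ ζ : DiagClass c →₀ ℂ, (∀ σ ∈ ζ.support, ∀ τ ∈ ζ.support,
      simulation hJ c i σ = simulation hJ c i τ → σ = τ) →
      ‖Finsupp.linearCombination ℂ (fun σ => tensorBasisVec (P := P) σ.1) ζ‖ =
        ‖Finsupp.linearCombination ℂ (fun σ => basisVec (simulation hJ c i σ)) ζ‖ := by
    intro ζ hζ
    refine norm_linearCombination_congr ζ fun σ hσ τ hτ => ?_
    rw [orthonormal_iff_ite.1 orthonormal_tensorBasisVec,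
      orthonormal_iff_ite.1 orthonormal_basisVec]
    exact if_congr ⟨fun e => by rw [Subtype.ext e], fun e => congrArg _ (hζ σ hσ τ hτ e)⟩ rfl rfl
  rw [h₂, key η hη, key ξ hξ, ← hi]
  exact T.1.le_opNorm _

/-- Basis vectors of different classes are orthogonal and simulated pairs respect the classes, so
the estimates on the classes add up by the Pythagorean theorem. -/
theorem norm_snd_le (h : Simulated hJ T) : ‖T.2‖ ≤ ‖T.1‖ := by
  let E : DiagQuotient P → Submodule ℂ (HilbertTensor ℓ²(P, ℂ) ℓ²(P, ℂ)) := fun c =>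
    Submodule.span ℂ (Set.range fun σ : DiagClass c => tensorBasisVec σ.1)
  have hE : OrthogonalFamily ℂ (fun c => E c) fun c => (E c).subtypeₗᵢ := by
    refine OrthogonalFamily.of_pairwise fun c d hcd => ?_
    refine Submodule.isOrtho_span.2 ?_
    rintro _ ⟨σ, rfl⟩ _ ⟨τ, rfl⟩
    refine orthonormal_tensorBasisVec.inner_eq_zero fun hστ => hcd ?_
    rw [← σ.2, ← τ.2, hστ]
  have hmem : ∀ c, ∀ v ∈ E c, T.2 v ∈ E c ∧ ‖T.2 v‖ ≤ ‖T.1‖ * ‖v‖ := by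
    intro c v hv
    obtain ⟨ξ, rfl⟩ := (Finsupp.mem_span_range_iff_exists_finsupp ..).1 hv
    refine ⟨?_, h.norm_apply_linearCombination_le ξ⟩
    obtain ⟨η, h₂, -⟩ := h c ξ
    exact (Finsupp.mem_span_range_iff_exists_finsupp ..).2 ⟨η, h₂.symm⟩
  have hdense : Dense ((⨆ c, E c : Submodule ℂ _) : Set (HilbertTensor ℓ²(P, ℂ) ℓ²(P, ℂ))) := by
    refine dense_span_tensorBasisVec.mono (Submodule.span_le.2 ?_)
    rintro _ ⟨σ, rfl⟩
    exact Submodule.mem_iSup_of_mem (Quotient.mk _ σ) (Submodule.subset_span ⟨⟨σ, rfl⟩, rfl⟩)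
  refine T.2.opNorm_le_bound (norm_nonneg _) fun v => ?_
  refine isClosed_property hdense.denseRange_val
    (isClosed_le (T.2.continuous.norm) (continuous_const.mul continuous_norm)) (fun ⟨v, hv⟩ => ?_) v
  obtain ⟨f, hf, rfl⟩ := (Submodule.mem_iSup_iff_exists_finsupp _ _).1 hv
  have h₁ : ‖∑ c ∈ f.support, f c‖ ^ 2 = ∑ c ∈ f.support, ‖f c‖ ^ 2 :=
    hE.norm_sum (fun c => ⟨f c, hf c⟩) f.support
  have h₂ : ‖∑ c ∈ f.support, T.2 (f c)‖ ^ 2 = ∑ c ∈ f.support, ‖T.2 (f c)‖ ^ 2 :=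
    hE.norm_sum (fun c => ⟨T.2 (f c), (hmem c _ (hf c)).1⟩) f.support
  change ‖T.2 (f.sum fun _ v => v)‖ ≤ ‖T.1‖ * ‖f.sum fun _ v => v‖
  refine (sq_le_sq₀ (norm_nonneg _) (by positivity)).1 ?_
  rw [Finsupp.sum, map_sum, h₂, mul_pow, h₁, Finset.mul_sum]
  refine Finset.sum_le_sum fun c _ => ?_
  rw [← mul_pow]
  exact pow_le_pow_left₀ (norm_nonneg _) (hmem c _ (hf c)).2 2

end Simulated

end Estimate

/-! ### The comultiplication -/

section Comultiplication

variable {P : Type*} [Monoid P] [IsLeftOre P]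

variable (P) in
/-- The `C⋆`-algebra of pairs of operators generated by the pairs `(V_p, V_p ⊗ V_p)`. It is the
graph of the comultiplication. -/
noncomputable def comulGraph : StarSubalgebra ℂ ((ℓ²(P, ℂ) →L[ℂ] ℓ²(P, ℂ)) ×
    (HilbertTensor ℓ²(P, ℂ) ℓ²(P, ℂ) →L[ℂ] HilbertTensor ℓ²(P, ℂ) ℓ²(P, ℂ))) :=
  (StarAlgebra.adjoin ℂ (Set.range fun p : P => ((regIsometry p).toContinuousLinearMap,
    opTensor (regIsometry p).toContinuousLinearMap
      (regIsometry p).toContinuousLinearMap))).topologicalClosure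

theorem mem_comulGraph (p : P) : ((regIsometry p).toContinuousLinearMap,
    opTensor (regIsometry p).toContinuousLinearMap
      (regIsometry p).toContinuousLinearMap) ∈ comulGraph P :=
  StarSubalgebra.le_topologicalClosure _ (StarAlgebra.subset_adjoin ℂ _ ⟨p, rfl⟩)

theorem norm_snd_le_of_mem_comulGraph (hJ : ConstructibleIndependent P) {T}
    (hT : T ∈ comulGraph P) : ‖T.2‖ ≤ ‖T.1‖ := by
  refine closure_minimal (fun S hS => ?_)
    (isClosed_le continuous_snd.norm continuous_fst.norm) hT
  suffices h : Simulated hJ S from h.norm_snd_le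
  change S ∈ Algebra.adjoin ℂ _ at hS
  induction hS using Algebra.adjoin_induction with
  | mem S hS =>
    rcases hS with ⟨p, rfl⟩ | ⟨p, hp⟩
    · exact Simulated.regIsometry hJ p
    · rw [← star_star S, ← hp]
      exact Simulated.star_regIsometry hJ p
  | algebraMap r => exact Simulated.algebraMap r
  | add S S' _ _ h h' => exact h.add h'
  | mul S S' _ _ h h' => exact h.mul h'

theorem snd_mem_minTensor_of_mem_comulGraph {T} (hT : T ∈ comulGraph P) :
    T.2 ∈ minTensor (reducedCStar P) (reducedCStar P) := by
  let f : ((ℓ²(P, ℂ) →L[ℂ] ℓ²(P, ℂ)) ×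
      (HilbertTensor ℓ²(P, ℂ) ℓ²(P, ℂ) →L[ℂ] HilbertTensor ℓ²(P, ℂ) ℓ²(P, ℂ))) →⋆ₐ[ℂ]
      (HilbertTensor ℓ²(P, ℂ) ℓ²(P, ℂ) →L[ℂ] HilbertTensor ℓ²(P, ℂ) ℓ²(P, ℂ)) :=
    StarAlgHom.snd ℂ _ _
  have h : comulGraph P ≤ (minTensor (reducedCStar P) (reducedCStar P)).comap f := by
    refine StarSubalgebra.topologicalClosure_minimal (StarAlgebra.adjoin_le ?_)
      ((StarSubalgebra.isClosed_topologicalClosure _).preimage continuous_snd)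
    rintro _ ⟨p, rfl⟩
    exact (minTmul (genV p) (genV p)).2
  exact h hT

variable (P) in
/-- The projection of the graph to `ℓ²(P)`. -/
noncomputable def comulGraphFst : comulGraph P →⋆ₐ[ℂ] (ℓ²(P, ℂ) →L[ℂ] ℓ²(P, ℂ)) :=
  (StarAlgHom.fst ℂ _ _).comp (comulGraph P).subtype

theorem isometry_comulGraphFst (hJ : ConstructibleIndependent P) : Isometry (comulGraphFst P) :=
  AddMonoidHomClass.isometry_of_norm _ fun T =>
    (max_eq_left (norm_snd_le_of_mem_comulGraph hJ T.2)).symm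

theorem reducedCStar_le_range_comulGraphFst (hJ : ConstructibleIndependent P) :
    reducedCStar P ≤ (comulGraphFst P).range := by
  have : CompleteSpace (comulGraph P) :=
    (StarSubalgebra.isClosed_topologicalClosure _).completeSpace_coe
  refine StarSubalgebra.topologicalClosure_minimal (StarAlgebra.adjoin_le ?_)
    (isometry_comulGraphFst hJ).isClosedEmbedding.isClosed_range
  rintro _ ⟨p, rfl⟩
  exact ⟨⟨_, mem_comulGraph p⟩, rfl⟩

/-- The comultiplication: the graph projects isometrically, hence bijectively, to the reduced
semigroup `C⋆`-algebra, and the second component of the preimage is the value. -/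
noncomputable def comul (hJ : ConstructibleIndependent P) :
    reducedCStar P →⋆ₐ[ℂ] minTensor (reducedCStar P) (reducedCStar P) :=
  (StarAlgHom.codRestrict ((StarAlgHom.snd ℂ _ _).comp (comulGraph P).subtype) _
      fun T => snd_mem_minTensor_of_mem_comulGraph T.2).comp
    ((StarAlgEquiv.ofInjective (comulGraphFst P)
        (isometry_comulGraphFst hJ).injective).symm.toStarAlgHom.comp
      (StarSubalgebra.inclusion (reducedCStar_le_range_comulGraphFst hJ)))

theorem comul_genV (hJ : ConstructibleIndependent P) (p : P) :
    comul hJ (genV p) = minTmul (genV p) (genV p) := by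
  have h : (StarAlgEquiv.ofInjective (comulGraphFst P) (isometry_comulGraphFst hJ).injective).symm
      (StarSubalgebra.inclusion (reducedCStar_le_range_comulGraphFst hJ) (genV p)) =
      ⟨_, mem_comulGraph p⟩ := (StarAlgEquiv.symm_apply_eq _).2 rfl
  exact Subtype.ext (congrArg (fun T : comulGraph P => T.1.2) h)

/-- `⋆`-homomorphisms between `C⋆`-algebras are continuous, so they are determined on generators. -/
theorem reducedCStar_hom_ext {A : Type*} [CStarAlgebra A] {φ ψ : reducedCStar P →⋆ₐ[ℂ] A}
    (h : ∀ p, φ (genV p) = ψ (genV p)) : φ = ψ := by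
  have : IsClosed (reducedCStar P : Set (ℓ²(P, ℂ) →L[ℂ] ℓ²(P, ℂ))) :=
    StarSubalgebra.isClosed_topologicalClosure _
  have hc : ∀ χ : reducedCStar P →⋆ₐ[ℂ] A, Continuous χ := fun χ =>
    AddMonoidHomClass.continuous_of_bound χ 1 fun a => by
      rw [one_mul]; exact NonUnitalStarAlgHom.norm_apply_le χ a
  refine StarAlgHom.ext_topologicalClosure (hc φ) (hc ψ) (StarAlgHom.ext_adjoin ?_)
  rintro ⟨_, _⟩ ⟨p, rfl⟩
  exact h p

end Comultiplication

end SemigroupCStar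

open SemigroupCStar in
theorem mainTheorem11 (P : Type*) [Monoid P] [IsLeftOre P]
    (hJ : ConstructibleIndependent P) :
    ∃! Δ : reducedCStar P →⋆ₐ[ℂ] minTensor (reducedCStar P) (reducedCStar P),
      ∀ p : P, Δ (genV p) = minTmul (genV p) (genV p) := by
  have : IsClosed (minTensor (reducedCStar P) (reducedCStar P) :
      Set (HilbertTensor ℓ²(P, ℂ) ℓ²(P, ℂ) →L[ℂ] HilbertTensor ℓ²(P, ℂ) ℓ²(P, ℂ))) :=
    StarSubalgebra.isClosed_topologicalClosure _
  exact ⟨comul hJ, comul_genV hJ, fun Δ hΔ =>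
    reducedCStar_hom_ext fun p => (hΔ p).trans (comul_genV hJ p).symm⟩
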